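/- Let $X$ be a $\sigma$-compact metric space with its Borel $\sigma$-algebra, and let $\sigma$ be a $\sigma$-finite diffuse (atomless) Borel measure on $X$ that is finite on compact sets. Let $\Omega^X$ be the configuration space, i.e. the set of at most countable, locally finite subsets $\omega$ of $X$, each identified with the point measure $\sum_{x\in\omega}\epsilon_x$, with the $\sigma$-algebra generated by the maps $\omega\mapsto\omega(B)$, $B\subset X$ Borel. Let $\pi_\sigma$ be the Poisson probability measure on $\Omega^X$ with intensity $\sigma$: for all pairwise disjoint compact sets $K_1,\dots,K_m\subset X$, the counts $\omega(K_1),\dots,\omega(K_m)$ are independent and Poisson distributed with parameters $\sigma(K_1),\dots,\sigma(K_m)$. Write $E$ for the expectation under $\pi_\sigma$. For $F:\Omega^X\to\mathbb{R}$ and $s_1,\dots,s_k\in X$ put $(\varepsilon^+_{s_1,\dots,s_k}F)(\omega)=F(\omega\cup\{s_1,\dots,s_k\})$. Let $A\subset X$ be a Borel set with $\lambda:=\sigma(A)<\infty$ and let $Z(\omega)=\omega(A)$. Then $Z$ is Poisson distributed with parameter $\lambda$. For every bounded random variable (measurable function) $F:\Omega^X\to\mathbb{R}$ and every integer $n\ge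 0$, all the integrands below are integrable and $$E[F Z^n]=\sum_{k=0}^n S(n,k)\int_{A^k}E\big[\varepsilon^+_{s_1,\dots,s_k}F\big]\,\sigma(ds_1)\cdots\sigma(ds_k),$$ where $S(n,k)$ is the Stirling number of the second kind, i.e. the number of partitions of a set of $n$ elements into $k$ non-empty subsets (the term $k=0$ is $S(n,0)\,E[F]$). In particular, for $F=1$, $$E[Z^n]=B_n(\lambda):=\sum_{k=0}^n S(n,k)\,\lambda^k,$$ the Bell (Touchard) polynomial of order $n$ at $\lambda$. -/

import Mathlib

open MeasureTheory ProbabilityTheory Set Topology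
open scoped ENNReal NNReal

/-- The configuration space on `X`: at most countable and locally finite subsets of `X`. -/
@[ext]
structure Configuration (X : Type*) [TopologicalSpace X] where
  /-- The set of points of the configuration. -/
  carrier : Set X
  countable : carrier.Countable
  locallyFinite : ∀ x : X, ∃ U ∈ 𝓝 x, (carrier ∩ U).Finite

namespace Configuration

/-- The point measure `∑ ε_x`, over the points `x` of `ω`, with which a configuration `ω` is
identified. -/
noncomputable def toMeasure {X : Type*} [TopologicalSpace X] [MeasurableSpace X]
    (ω : Configuration X) : Measure X :=
  Measure.sum fun x : ω.carrier => Measure.dirac (x : X)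

/-- The `σ`-algebra on the configuration space: the one generated by the counting maps
`ω ↦ ω(B)`, for `B` measurable (this is how `Measure X` carries its `σ`-algebra). -/
noncomputable instance instMeasurableSpace {X : Type*} [TopologicalSpace X] [MeasurableSpace X] :
    MeasurableSpace (Configuration X) :=
  MeasurableSpace.comap toMeasure inferInstance

/-- The configuration `ω ∪ {s_1, …, s_k}`. -/
def addPoints {X : Type*} [TopologicalSpace X] (ω : Configuration X) {k : ℕ} (s : Fin k → X) :
    Configuration X where
  carrier := ω.carrier ∪ Set.range s
  countable := ω.countable.union (Set.countable_range s)
  locallyFinite x := by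
    obtain ⟨U, hU, hfin⟩ := ω.locallyFinite x
    refine ⟨U, hU, ?_⟩
    rw [Set.union_inter_distrib_right]
    exact hfin.union ((Set.finite_range s).subset Set.inter_subset_left)

end Configuration

/-- The addition operator: `(ε⁺_s F)(ω) = F(ω ∪ {s_1, …, s_k})`. -/
def addOperator {X : Type*} [TopologicalSpace X] {k : ℕ} (s : Fin k → X)
    (F : Configuration X → ℝ) : Configuration X → ℝ :=
  fun ω => F (ω.addPoints s)

/-- `P` is the Poisson measure with intensity `σ` on the configuration space: for pairwise disjoint
compact sets `K_1, …, K_n`, the counts `ω(K_1), …, ω(K_n)` are independent, and each `ω(K_i)` is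
Poisson distributed with parameter `σ(K_i)`.
It is meant for `σ` finite on compact sets. -/
structure IsPoissonMeasure {X : Type*} [TopologicalSpace X] [MeasurableSpace X]
    (σ : Measure X) (P : Measure (Configuration X)) : Prop where
  law : ∀ K : Set X, IsCompact K →
    HasLaw (fun ω : Configuration X => ω.toMeasure K)
      ((poissonMeasure (σ K).toNNReal).map (fun m : ℕ => (m : ℝ≥0∞))) P
  indep : ∀ (n : ℕ) (K : Fin n → Set X), (∀ i, IsCompact (K i)) →
    Pairwise (fun i j => Disjoint (K i) (K j)) →
    iIndepFun (fun (i : Fin n) (ω : Configuration X) => ω.toMeasure (K i)) P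

/-- The Bell (Touchard) polynomial `B_n(x) = ∑_{k=0}^n S(n,k) x^k`. -/
noncomputable def bellPolynomial (n : ℕ) (x : ℝ) : ℝ :=
  ∑ k ∈ Finset.range (n + 1), (Nat.stirlingSecond n k : ℝ) * x ^ k

/-! Everything rests on the Mecke formula E[ω(A) G(ω)] = ∫_A E[G(ω ∪ {x})] σ(dx)
(`lintegral_mul_toMeasure`). Both sides integrate G against a finite measure, and the events {ω ∩ K
= ∅}, K compact, form a π-system generating the σ-algebra
(`measurableSpace_eq_generateFrom_voidEvents`), so indicators of such events suffice. There the
points of ω in A lie in A \ K, and independence over disjoint compacts plus inner regularity turns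
both sides into P(ω ∩ K = ∅) σ(A \ K) (`setLIntegral_voidEvent`).

As σ is diffuse, an added point is almost surely new and raises the count N of A by one. Hence k
iterations express E[N(N-1)⋯(N-k+1) G] as an integral over A^k
(`lintegral_descFactorial_ncard_mul`), and expanding x^n in falling factorials with coefficients
S(n,k) gives the moments. The Mecke formula for functions of N also yields (n+1) P(N = n+1) = σ(A)
P(N = n), which forces the Poisson law for Borel A. -/

namespace Configuration

/-! ### Counts of points -/

section Counting

variable {X : Type*} [TopologicalSpace X] [MeasurableSpace X]

lemma toMeasure_apply [MeasurableSingletonClass X] (ω : Configuration X) {S : Set X}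
    (hS : MeasurableSet S) : ω.toMeasure S = ((ω.carrier ∩ S).encard : ℝ≥0∞) := by
  have h : ω.toMeasure = Measure.count.restrict ω.carrier := by
    ext T hT
    rw [Measure.restrict_apply hT, Measure.count_apply (hT.inter ω.countable.measurableSet),
      toMeasure, Measure.sum_apply _ hT]
    have h1 : T ∩ ω.carrier = Subtype.val '' (Subtype.val ⁻¹' T : Set ω.carrier) := by
      rw [Subtype.image_preimage_coe, inter_comm]
    rw [h1, Subtype.val_injective.encard_image, ← ENNReal.tsum_set_one,
      tsum_subtype (Subtype.val ⁻¹' T : Set ω.carrier) (fun _ => (1 : ℝ≥0∞))]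
    refine tsum_congr fun x => ?_
    rw [Measure.dirac_apply' _ hT]
    rfl
  rw [h, Measure.restrict_apply hS, inter_comm,
    Measure.count_apply (ω.countable.measurableSet.inter hS)]

/-- No finiteness is needed: for infinitely many points both sides default to 0. -/
lemma toMeasure_real_eq_ncard [MeasurableSingletonClass X] (ω : Configuration X) {S : Set X}
    (hS : MeasurableSet S) : ω.toMeasure.real S = (ω.carrier ∩ S).ncard := by
  rw [measureReal_def, ω.toMeasure_apply hS, Set.ncard]
  cases (ω.carrier ∩ S).encard <;> simp

lemma toMeasure_eq_zero_iff [MeasurableSingletonClass X] (ω : Configuration X) {S : Set X}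
    (hS : MeasurableSet S) : ω.toMeasure S = 0 ↔ Disjoint ω.carrier S := by
  rw [ω.toMeasure_apply hS, ENat.toENNReal_eq_zero, encard_eq_zero, disjoint_iff_inter_eq_empty]

lemma measurable_toMeasure : Measurable (toMeasure : Configuration X → Measure X) :=
  comap_measurable _

lemma measurable_toMeasure_apply {S : Set X} (hS : MeasurableSet S) :
    Measurable fun ω : Configuration X => ω.toMeasure S :=
  (Measure.measurable_coe hS).comp measurable_toMeasure

lemma measurable_ncard_inter [MeasurableSingletonClass X] {S : Set X} (hS : MeasurableSet S) :
    Measurable fun ω : Configuration X => (ω.carrier ∩ S).ncard := by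
  have h : (fun ω : Configuration X => (ω.carrier ∩ S).ncard) =
      fun ω => ⌊(ω.toMeasure S).toReal⌋₊ := by
    ext ω
    rw [← measureReal_def, ω.toMeasure_real_eq_ncard hS, Nat.floor_natCast]
  rw [h]
  exact (measurable_toMeasure_apply hS).ennreal_toReal.nat_floor

end Counting

/-! ### Void events generate the σ-algebra -/

lemma finite_inter_isCompact {X : Type*} [TopologicalSpace X] (ω : Configuration X) {K : Set X}
    (hK : IsCompact K) : (ω.carrier ∩ K).Finite := by
  refine hK.induction_on (p := fun S => (ω.carrier ∩ S).Finite) (by simp)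
    (fun s t hst ht => ht.subset (by gcongr)) (fun s t hs ht => ?_) fun x _ => ?_
  · rw [inter_union_distrib_left]
    exact hs.union ht
  · obtain ⟨U, hU, hfin⟩ := ω.locallyFinite x
    exact ⟨U, mem_nhdsWithin_of_mem_nhds hU, hfin⟩

/-- Finitely many points of a Hausdorff space have disjoint basic neighbourhoods. The basis being
countable, "at least n points" becomes a countable union of finite intersections of hitting events.
-/
lemma natCast_le_encard_iff_exists_disjoint_countableBasis {X : Type*} [TopologicalSpace X]
    [T2Space X] [SecondCountableTopology X] (T : Set X) (n : ℕ) :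
    (n : ℕ∞) ≤ T.encard ↔ ∃ f : Fin n → TopologicalSpace.countableBasis X,
      Pairwise (fun i j => Disjoint (f i : Set X) (f j)) ∧ ∀ i, (T ∩ f i).Nonempty := by
  constructor
  · intro h
    obtain ⟨t, htT, ht⟩ := Set.exists_subset_encard_eq h
    have htf : t.Finite := Set.finite_of_encard_eq_coe ht
    obtain ⟨U, hU, hd⟩ := htf.t2_separation
    have hcard : Nat.card t = n := by
      rw [Nat.card_coe_set_eq, Set.ncard, ht, ENat.toNat_natCast]
    have := htf.to_subtype
    let e : Fin n ≃ t := (Finite.equivFinOfCardEq hcard).symm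
    have hb := TopologicalSpace.isBasis_countableBasis X
    have hex (i : Fin n) : ∃ V ∈ TopologicalSpace.countableBasis X,
        (e i : X) ∈ V ∧ V ⊆ U (e i) :=
      hb.exists_subset_of_mem_open (hU _).1 (hU _).2
    choose V hV heV hVU using hex
    refine ⟨fun i => ⟨V i, hV i⟩, fun i j hij => ?_, fun i => ⟨e i, htT (e i).2, heV i⟩⟩
    refine (hd (e i).2 (e j).2 fun h => hij (e.injective (Subtype.ext h))).mono (hVU i) (hVU j)
  · rintro ⟨f, hd, hne⟩
    choose p hp using hne
    have hinj : Function.Injective p := fun i j hij => by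
      by_contra hne
      exact Set.disjoint_left.mp (hd hne) (hp i).2 (hij ▸ (hp j).2)
    calc (n : ℕ∞) = (range p).encard := by
          rw [← image_univ, hinj.encard_image, encard_univ]; simp
      _ ≤ T.encard := encard_le_encard (range_subset_iff.mpr fun i => (hp i).1)

/-- The events that a compact set contains no point of the configuration. -/
def voidEvents (X : Type*) [TopologicalSpace X] : Set (Set (Configuration X)) :=
  {V | ∃ K : Set X, IsCompact K ∧ V = {ω | Disjoint ω.carrier K}}

lemma isPiSystem_voidEvents (X : Type*) [TopologicalSpace X] : IsPiSystem (voidEvents X) := by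
  rintro _ ⟨K, hK, rfl⟩ _ ⟨L, hL, rfl⟩ -
  exact ⟨K ∪ L, hK.union hL, by ext ω; simp [disjoint_union_right]⟩

/-- In a metric space U is a countable union of closed sets, so K ∩ U is a countable union of
compacts. -/
lemma measurableSet_generateFrom_voidEvents_inter {X : Type*} [MetricSpace X] {K U : Set X}
    (hK : IsCompact K) (hU : IsOpen U) :
    MeasurableSet[MeasurableSpace.generateFrom (voidEvents X)]
      {ω : Configuration X | Disjoint ω.carrier (K ∩ U)} := by
  obtain ⟨F, hF, -, hFU, -⟩ := hU.exists_iUnion_isClosed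
  have h : {ω : Configuration X | Disjoint ω.carrier (K ∩ U)} =
      ⋂ n, {ω | Disjoint ω.carrier (K ∩ F n)} := by
    ext ω
    simp [← hFU, inter_iUnion, disjoint_iUnion_right]
  rw [h]
  exact MeasurableSet.iInter fun n =>
    MeasurableSpace.measurableSet_generateFrom ⟨_, hK.inter_right (hF n), rfl⟩

section Generate

variable {X : Type*} [MetricSpace X] [MeasurableSpace X] [BorelSpace X]

lemma measurable_generateFrom_voidEvents_toMeasure_isCompact [SecondCountableTopology X]
    {K : Set X} (hK : IsCompact K) :
    Measurable[MeasurableSpace.generateFrom (voidEvents X)]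
      fun ω : Configuration X => ω.toMeasure K := by
  let _ : MeasurableSpace (Configuration X) := MeasurableSpace.generateFrom (voidEvents X)
  have hmeas (n : ℕ) : MeasurableSet
      {ω : Configuration X | (n : ℕ∞) ≤ (ω.carrier ∩ K).encard} := by
    simp_rw [natCast_le_encard_iff_exists_disjoint_countableBasis, ofPred_exists, ofPred_and,
      ofPred_forall]
    refine MeasurableSet.iUnion fun f => (MeasurableSet.const _).inter <|
      MeasurableSet.iInter fun i => ?_
    have h := measurableSet_generateFrom_voidEvents_inter hK
      ((TopologicalSpace.isBasis_countableBasis X).isOpen (f i).2)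
    convert h.compl using 1
    ext ω
    simp [disjoint_iff_inter_eq_empty, nonempty_iff_ne_empty, inter_assoc]
  -- A finite count is the largest n for which it is at least n.
  have h (ω : Configuration X) : ω.toMeasure K =
      ⨆ n : ℕ, {ω : Configuration X | (n : ℕ∞) ≤ (ω.carrier ∩ K).encard}.indicator
        (fun _ => (n : ℝ≥0∞)) ω := by
    rw [ω.toMeasure_apply hK.measurableSet]
    have hfin := ω.finite_inter_isCompact hK
    rw [← hfin.cast_ncard_eq, ENat.toENNReal_coe]
    refine le_antisymm (le_iSup_of_le (ω.carrier ∩ K).ncard ?_) (iSup_le fun n => ?_)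
    · rw [indicator_of_mem]
      simp [hfin.cast_ncard_eq]
    · refine indicator_apply_le' (fun h => ?_) (by simp)
      rw [mem_ofPred_eq, ← hfin.cast_ncard_eq, Nat.cast_le] at h
      exact_mod_cast h
  simp_rw [h]
  exact Measurable.iSup fun n => measurable_const.indicator (hmeas n)

lemma measurableSet_voidEvent {K : Set X} (hK : MeasurableSet K) :
    MeasurableSet {ω : Configuration X | Disjoint ω.carrier K} := by
  have h : {ω : Configuration X | Disjoint ω.carrier K} = (fun ω => ω.toMeasure K) ⁻¹' {0} := by
    ext ω
    simp [ω.toMeasure_eq_zero_iff hK]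
  rw [h]
  exact measurable_toMeasure_apply hK (measurableSet_singleton 0)

/-- The `σ`-algebra on the configuration space is generated by the void events. -/
theorem measurableSpace_eq_generateFrom_voidEvents [SigmaCompactSpace X] :
    (instMeasurableSpace : MeasurableSpace (Configuration X)) =
      MeasurableSpace.generateFrom (voidEvents X) := by
  refine le_antisymm ?_ (MeasurableSpace.generateFrom_le ?_)
  · refine (@measurable_iff_comap_le _ _ (_) (_) _).mp ?_
    let _ : MeasurableSpace (Configuration X) := MeasurableSpace.generateFrom (voidEvents X)
    have hK (n : ℕ) : IsCompact (compactCovering X n) := isCompact_compactCovering X n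
    -- The π-λ extension from closed sets to Borel sets needs finite measures, hence the restriction
    -- to a compact exhaustion.
    have hrestrict (n : ℕ) : Measurable fun ω : Configuration X =>
        ω.toMeasure.restrict (compactCovering X n) := by
      have (ω : Configuration X) :
          IsFiniteMeasure (ω.toMeasure.restrict (compactCovering X n)) := by
        refine ⟨?_⟩
        rw [Measure.restrict_apply_univ, ω.toMeasure_apply (hK n).measurableSet,
          ← (ω.finite_inter_isCompact (hK n)).cast_ncard_eq]
        simp
      refine Measurable.measure_of_isPiSystem
        (BorelSpace.measurable_eq.trans borel_eq_generateFrom_isClosed) isPiSystem_isClosed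
        (fun F hF => ?_) ?_
      · have hF : IsClosed F := hF
        simp_rw [Measure.restrict_apply hF.measurableSet]
        exact measurable_generateFrom_voidEvents_toMeasure_isCompact ((hK n).inter_left hF)
      · simp_rw [Measure.restrict_apply_univ]
        exact measurable_generateFrom_voidEvents_toMeasure_isCompact (hK n)
    refine Measure.measurable_of_measurable_coe _ fun B hB => ?_
    have h (ω : Configuration X) : ω.toMeasure B =
        ⨆ n, ω.toMeasure.restrict (compactCovering X n) B := by
      simp_rw [Measure.restrict_apply hB]
      rw [← Monotone.measure_iUnion, ← inter_iUnion, iUnion_compactCovering, inter_univ]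
      exact fun i j hij => inter_subset_inter_right _ (compactCovering_subset X hij)
    simp_rw [h]
    exact Measurable.iSup fun n => (Measure.measurable_coe hB).comp (hrestrict n)
  · rintro _ ⟨K, hK, rfl⟩
    exact measurableSet_voidEvent hK.measurableSet

/-- Adding points to a configuration is jointly measurable. -/
lemma measurable_addPoints [SigmaCompactSpace X] (k : ℕ) :
    Measurable fun p : (Fin k → X) × Configuration X => p.2.addPoints p.1 := by
  suffices h : @Measurable _ _ _ (MeasurableSpace.generateFrom (voidEvents X))
      fun p : (Fin k → X) × Configuration X => p.2.addPoints p.1 by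
    rwa [← measurableSpace_eq_generateFrom_voidEvents] at h
  refine measurable_generateFrom ?_
  rintro _ ⟨K, hK, rfl⟩
  -- A union misses K exactly when both parts do, so the preimage is a rectangle.
  have h : (fun p : (Fin k → X) × Configuration X => p.2.addPoints p.1) ⁻¹'
      {ω | Disjoint ω.carrier K} =
      (univ.pi fun _ => Kᶜ) ×ˢ {ω | Disjoint ω.carrier K} := by
    ext p
    simp only [addPoints, mem_preimage, mem_ofPred_eq, disjoint_union_left, mem_prod, mem_univ_pi,
      mem_compl_iff]
    rw [and_comm, Set.disjoint_left (s := range p.1), forall_mem_range]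
  rw [h]
  exact (MeasurableSet.univ_pi fun _ => hK.measurableSet.compl).prod
    (measurableSet_voidEvent hK.measurableSet)

end Generate

end Configuration

/-! ### The Mecke formula and the law of the counts -/

lemma succ_mul_poissonMeasure_singleton_succ (r : ℝ≥0) (n : ℕ) :
    ((n + 1 : ℕ) : ℝ≥0∞) * poissonMeasure r {n + 1} = r * poissonMeasure r {n} := by
  rw [poissonMeasure_singleton, poissonMeasure_singleton, ← ENNReal.ofReal_natCast,
    ← ENNReal.ofReal_coe_nnreal, ← ENNReal.ofReal_mul (by positivity),
    ← ENNReal.ofReal_mul (by positivity)]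
  congr 1
  rw [Nat.factorial_succ]
  push_cast
  field_simp
  ring

lemma lintegral_natCast_poissonMeasure (r : ℝ≥0) :
    ∫⁻ n : ℕ, (n : ℝ≥0∞) ∂poissonMeasure r = r := by
  rw [lintegral_countable', tsum_eq_zero_add' ENNReal.summable]
  simp_rw [succ_mul_poissonMeasure_singleton_succ, ENNReal.tsum_mul_left]
  have h : ∑' n : ℕ, poissonMeasure r {n} = 1 := by
    have := lintegral_countable' (μ := poissonMeasure r) fun _ => 1
    simpa using this.symm
  simp [h]

namespace IsPoissonMeasure

open Configuration

lemma lintegral_toMeasure_isCompact {X : Type*} [TopologicalSpace X] [MeasurableSpace X]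
    {σ : Measure X} [IsFiniteMeasureOnCompacts σ] {P : Measure (Configuration X)}
    (hP : IsPoissonMeasure σ P) {K : Set X} (hK : IsCompact K) :
    ∫⁻ ω, ω.toMeasure K ∂P = σ K := by
  have h := lintegral_map' (μ := P) (f := fun x : ℝ≥0∞ => x) measurable_id.aemeasurable
    (hP.law K hK).aemeasurable
  rw [← h, (hP.law K hK).map_eq, lintegral_map (f := fun x : ℝ≥0∞ => x) measurable_id .of_discrete,
    lintegral_natCast_poissonMeasure, ENNReal.coe_toNNReal hK.measure_lt_top.ne]

variable {X : Type*} [MetricSpace X] [SigmaCompactSpace X] [MeasurableSpace X] [BorelSpace X]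
  {σ : Measure X} [IsFiniteMeasureOnCompacts σ] {P : Measure (Configuration X)}

/-- The void event is {ω(K) = 0}, hence independent of ω(L), whose mean is σ(L). -/
lemma setLIntegral_voidEvent_isCompact (hP : IsPoissonMeasure σ P) {K L : Set X}
    (hK : IsCompact K) (hL : IsCompact L) (hd : Disjoint K L) :
    ∫⁻ ω in {ω | Disjoint ω.carrier K}, ω.toMeasure L ∂P =
      P {ω | Disjoint ω.carrier K} * σ L := by
  have hind := (hP.indep 2 ![K, L] (by simp [Fin.forall_fin_two, hK, hL])
    (by
      intro i j hij
      fin_cases i <;> fin_cases j <;> first | exact absurd rfl hij | exact hd | exact hd.symm)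
    ).indepFun (show (0 : Fin 2) ≠ 1 by simp)
  have hV := measurableSet_voidEvent hK.measurableSet
  have hLm := measurable_toMeasure_apply hL.measurableSet
  have hφ : Measurable (({0} : Set ℝ≥0∞).indicator (1 : ℝ≥0∞ → ℝ≥0∞)) :=
    measurable_one.indicator (measurableSet_singleton 0)
  have hmul := lintegral_mul_eq_lintegral_mul_lintegral_of_indepFun
    (hφ.comp (measurable_toMeasure_apply hK.measurableSet)) hLm
    (hind.comp hφ measurable_id)
  have hV' : ({0} : Set ℝ≥0∞).indicator (1 : ℝ≥0∞ → ℝ≥0∞) ∘ (fun ω => ω.toMeasure K) =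
      {ω : Configuration X | Disjoint ω.carrier K}.indicator 1 := by
    ext ω
    have hω : ω.toMeasure K ∈ ({0} : Set ℝ≥0∞) ↔ ω ∈ {ω | Disjoint ω.carrier K} :=
      ω.toMeasure_eq_zero_iff hK.measurableSet
    by_cases h : ω ∈ {ω : Configuration X | Disjoint ω.carrier K} <;>
      simp only [Function.comp_apply, indicator, hω, h, if_true, if_false, Pi.one_apply]
  rw [hV', lintegral_indicator_one hV, hP.lintegral_toMeasure_isCompact hL] at hmul
  rw [← hmul, ← lintegral_indicator hV]
  refine lintegral_congr fun ω => ?_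
  by_cases h : ω ∈ {ω : Configuration X | Disjoint ω.carrier K} <;> simp [h]

/-- As functions of B both sides are measures finite on compacts, hence inner regular: the compact
case determines the Borel one. -/
lemma setLIntegral_voidEvent [IsProbabilityMeasure P] (hP : IsPoissonMeasure σ P) {K B : Set X}
    (hK : IsCompact K) (hB : MeasurableSet B) (hd : Disjoint K B) :
    ∫⁻ ω in {ω | Disjoint ω.carrier K}, ω.toMeasure B ∂P =
      P {ω | Disjoint ω.carrier K} * σ B := by
  set V := {ω : Configuration X | Disjoint ω.carrier K}
  set μ : Measure X := (P.restrict V).bind toMeasure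
  have hμ {S : Set X} (hS : MeasurableSet S) : μ S = ∫⁻ ω in V, ω.toMeasure S ∂P :=
    Measure.bind_apply hS measurable_toMeasure.aemeasurable
  have : IsFiniteMeasureOnCompacts μ := ⟨fun L hL => by
    rw [hμ hL.measurableSet]
    exact (setLIntegral_le_lintegral _ _).trans_lt
      (hP.lintegral_toMeasure_isCompact hL ▸ hL.measure_lt_top)⟩
  rw [← hμ hB, hB.measure_eq_iSup_isCompact μ, hB.measure_eq_iSup_isCompact σ]
  simp_rw [ENNReal.mul_iSup]
  refine iSup_congr fun L => iSup_congr fun hLB => iSup_congr fun hL => ?_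
  rw [hμ hL.measurableSet,
    hP.setLIntegral_voidEvent_isCompact hK hL (hd.mono_right hLB)]

/-- The intensity measure of a Poisson measure. -/
theorem lintegral_toMeasure [IsProbabilityMeasure P] (hP : IsPoissonMeasure σ P) {B : Set X}
    (hB : MeasurableSet B) : ∫⁻ ω, ω.toMeasure B ∂P = σ B := by
  simpa using hP.setLIntegral_voidEvent isCompact_empty hB (empty_disjoint B)

/-- The **Mecke formula** on a set of finite intensity. -/
theorem lintegral_mul_toMeasure [SFinite σ] [IsProbabilityMeasure P] (hP : IsPoissonMeasure σ P)
    {A : Set X} (hA : MeasurableSet A) (hσA : σ A ≠ ∞) {G : Configuration X → ℝ≥0∞}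
    (hG : Measurable G) :
    ∫⁻ ω, ω.toMeasure A * G ω ∂P =
      ∫⁻ x in A, ∫⁻ ω, G (ω.addPoints fun _ : Fin 1 => x) ∂P ∂σ := by
  have hadd : Measurable fun p : X × Configuration X => p.2.addPoints fun _ : Fin 1 => p.1 :=
    (measurable_addPoints 1).comp
      (f := fun p : X × Configuration X => ((fun _ : Fin 1 => p.1), p.2)) (by fun_prop)
  have hAm : Measurable fun ω : Configuration X => ω.toMeasure A := measurable_toMeasure_apply hA
  set μ : Measure (Configuration X) := P.withDensity fun ω => ω.toMeasure A
  set ν : Measure (Configuration X) :=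
    ((σ.restrict A).prod P).map fun p => p.2.addPoints fun _ : Fin 1 => p.1
  have hfin : IsFiniteMeasure μ := isFiniteMeasure_withDensity (by rwa [hP.lintegral_toMeasure hA])
  have hvoid (V) (hV : V ∈ voidEvents X) : μ V = ν V := by
    obtain ⟨K, hK, rfl⟩ := hV
    have hVm := measurableSet_voidEvent hK.measurableSet
    have hpre : (fun p : X × Configuration X => p.2.addPoints fun _ : Fin 1 => p.1) ⁻¹'
        {ω | Disjoint ω.carrier K} = Kᶜ ×ˢ {ω | Disjoint ω.carrier K} := by
      ext p
      simp [addPoints, and_comm]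
    rw [withDensity_apply _ hVm, Measure.map_apply hadd hVm, hpre, Measure.prod_prod,
      Measure.restrict_apply hK.measurableSet.compl, mul_comm, inter_comm,
      ← hP.setLIntegral_voidEvent hK (hA.inter hK.measurableSet.compl)
        (disjoint_compl_right.mono_right inter_subset_right)]
    -- If ω misses K, its points in A all lie in A \ K.
    refine setLIntegral_congr_fun hVm fun ω hω => ?_
    have hω : Disjoint ω.carrier K := hω
    rw [toMeasure_apply _ hA, toMeasure_apply _ (hA.inter hK.measurableSet.compl)]
    congr 2
    ext x
    exact ⟨fun h => ⟨h.1, h.2, hω.notMem_of_mem_left h.1⟩, fun h => ⟨h.1, h.2.1⟩⟩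
  have hμν : μ = ν := by
    -- Equality of total masses is the case K = ∅.
    refine ext_of_generate_finite _ measurableSpace_eq_generateFrom_voidEvents
      (isPiSystem_voidEvents X) hvoid (hvoid _ ⟨∅, isCompact_empty, by simp⟩)
  calc ∫⁻ ω, ω.toMeasure A * G ω ∂P = ∫⁻ ω, G ω ∂μ :=
        (lintegral_withDensity_eq_lintegral_mul P hAm hG).symm
    _ = ∫⁻ p : X × Configuration X, G (p.2.addPoints fun _ : Fin 1 => p.1)
          ∂(σ.restrict A).prod P := by rw [hμν, lintegral_map hG hadd]
    _ = _ := lintegral_prod _ (hG.comp hadd).aemeasurable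

lemma ae_notMem [NullSingletonClass σ] [IsProbabilityMeasure P] (hP : IsPoissonMeasure σ P)
    (x : X) : ∀ᵐ ω ∂P, x ∉ ω.carrier := by
  have h := hP.lintegral_toMeasure (measurableSet_singleton x)
  rw [measure_singleton, lintegral_eq_zero_iff
    (measurable_toMeasure_apply (measurableSet_singleton x))] at h
  filter_upwards [h] with ω hω
  simpa using (ω.toMeasure_eq_zero_iff (measurableSet_singleton x)).mp hω

lemma ae_finite_inter [IsProbabilityMeasure P] (hP : IsPoissonMeasure σ P) {A : Set X}
    (hA : MeasurableSet A) (hσA : σ A ≠ ∞) : ∀ᵐ ω ∂P, (ω.carrier ∩ A).Finite := by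
  filter_upwards [ae_lt_top (measurable_toMeasure_apply hA)
    (by rwa [hP.lintegral_toMeasure hA])] with ω hω
  rw [ω.toMeasure_apply hA, ENat.toENNReal_lt_top] at hω
  exact encard_lt_top_iff.mp hω

lemma ae_toMeasure_eq_ncard [IsProbabilityMeasure P] (hP : IsPoissonMeasure σ P) {A : Set X}
    (hA : MeasurableSet A) (hσA : σ A ≠ ∞) :
    ∀ᵐ ω ∂P, ω.toMeasure A = ((ω.carrier ∩ A).ncard : ℝ≥0∞) := by
  filter_upwards [hP.ae_finite_inter hA hσA] with ω hω
  rw [ω.toMeasure_apply hA, ← hω.cast_ncard_eq]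
  rfl

lemma ae_ncard_addPoints [NullSingletonClass σ] [IsProbabilityMeasure P]
    (hP : IsPoissonMeasure σ P) {A : Set X} (hA : MeasurableSet A) (hσA : σ A ≠ ∞)
    {x : X} (hx : x ∈ A) :
    ∀ᵐ ω ∂P, ((ω.addPoints fun _ : Fin 1 => x).carrier ∩ A).ncard =
      (ω.carrier ∩ A).ncard + 1 := by
  filter_upwards [hP.ae_finite_inter hA hσA, hP.ae_notMem x] with ω hfin hω
  have h : (ω.addPoints fun _ : Fin 1 => x).carrier ∩ A = insert x (ω.carrier ∩ A) := by
    simp [addPoints, insert_inter_of_mem hx]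
  rw [h, ncard_insert_of_notMem (fun h => hω h.1) hfin]

/-- The Mecke formula, for a functional that depends on the number of points in `A`. -/
lemma lintegral_ncard_mul [SFinite σ] [NullSingletonClass σ] [IsProbabilityMeasure P]
    (hP : IsPoissonMeasure σ P) {A : Set X} (hA : MeasurableSet A) (hσA : σ A ≠ ∞)
    (g : ℕ → ℝ≥0∞) {G : Configuration X → ℝ≥0∞} (hG : Measurable G) :
    ∫⁻ ω, ((ω.carrier ∩ A).ncard : ℝ≥0∞) * g (ω.carrier ∩ A).ncard * G ω ∂P =
      ∫⁻ x in A, ∫⁻ ω, g ((ω.carrier ∩ A).ncard + 1) * G (ω.addPoints fun _ : Fin 1 => x)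
        ∂P ∂σ := by
  have hg : Measurable fun ω : Configuration X => g (ω.carrier ∩ A).ncard * G ω :=
    (measurable_from_nat.comp (measurable_ncard_inter hA)).mul hG
  calc _ = ∫⁻ ω, ω.toMeasure A * (g (ω.carrier ∩ A).ncard * G ω) ∂P := by
        refine lintegral_congr_ae ?_
        filter_upwards [hP.ae_toMeasure_eq_ncard hA hσA] with ω hω
        rw [hω, mul_assoc]
    _ = _ := by
        rw [hP.lintegral_mul_toMeasure hA hσA hg]
        refine setLIntegral_congr_fun hA fun x hx => lintegral_congr_ae ?_
        filter_upwards [hP.ae_ncard_addPoints hA hσA hx] with ω hω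
        rw [hω]

/-- The number of points in a set of finite intensity is Poisson distributed. -/
theorem hasLaw_ncard [SFinite σ] [NullSingletonClass σ] [IsProbabilityMeasure P]
    (hP : IsPoissonMeasure σ P) {A : Set X} (hA : MeasurableSet A) (hσA : σ A ≠ ∞) :
    HasLaw (fun ω : Configuration X => (ω.carrier ∩ A).ncard)
      (poissonMeasure (σ A).toNNReal) P := by
  have hN := measurable_ncard_inter hA
  refine ⟨hN.aemeasurable, ?_⟩
  set r := (σ A).toNNReal
  have hr : σ A = r := (ENNReal.coe_toNNReal hσA).symm
  set μ := P.map fun ω : Configuration X => (ω.carrier ∩ A).ncard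
  have : IsProbabilityMeasure μ := Measure.isProbabilityMeasure_map hN.aemeasurable
  -- The Mecke formula for the indicator of {N = n + 1}, which the added point turns into {N = n}.
  have hstep (n : ℕ) : ((n + 1 : ℕ) : ℝ≥0∞) * μ {n + 1} = r * μ {n} := by
    have h := hP.lintegral_ncard_mul hA hσA (({n + 1} : Set ℕ).indicator 1)
      (G := 1) measurable_one
    have h1 : ∫⁻ ω, ((ω.carrier ∩ A).ncard : ℝ≥0∞) * ({n + 1} : Set ℕ).indicator (1 : ℕ → ℝ≥0∞)
        (ω.carrier ∩ A).ncard * (1 : Configuration X → ℝ≥0∞) ω ∂P =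
        ((n + 1 : ℕ) : ℝ≥0∞) * μ {n + 1} := by
      rw [← lintegral_indicator_one (measurableSet_singleton _), ← lintegral_const_mul _ (by fun_prop),
        lintegral_map (by fun_prop) hN]
      refine lintegral_congr fun ω => ?_
      by_cases hω : (ω.carrier ∩ A).ncard = n + 1 <;> simp [hω]
    have h2 : ∫⁻ ω, ({n + 1} : Set ℕ).indicator (1 : ℕ → ℝ≥0∞)
        ((ω.carrier ∩ A).ncard + 1) ∂P = μ {n} := by
      rw [← lintegral_indicator_one (measurableSet_singleton _), lintegral_map (by fun_prop) hN]
      refine lintegral_congr fun ω => ?_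
      simp [indicator_apply]
    rw [h1] at h
    simp only [Pi.one_apply, mul_one, h2, lintegral_const, Measure.restrict_apply_univ] at h
    rw [h, hr, mul_comm]
  -- The shared recursion makes the two laws proportional; summing over n then equates their masses
  -- at 0.
  have hratio (n : ℕ) : μ {n} * poissonMeasure r {0} = μ {0} * poissonMeasure r {n} := by
    induction n with
    | zero => rfl
    | succ n ih =>
      have h0 : ((n + 1 : ℕ) : ℝ≥0∞) ≠ 0 := by simp
      refine (ENNReal.mul_right_inj h0 (ENNReal.natCast_ne_top _)).mp ?_
      rw [← mul_assoc, hstep, mul_left_comm, succ_mul_poissonMeasure_singleton_succ, mul_assoc, ih,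
        mul_left_comm]
  have hsum (ρ : Measure ℕ) [IsProbabilityMeasure ρ] : ∑' n : ℕ, ρ {n} = 1 := by
    simpa using (lintegral_countable' (μ := ρ) fun _ => 1).symm
  have hzero : poissonMeasure r {0} = μ {0} := by
    have h := tsum_congr (L := .unconditional ℕ) hratio
    rwa [ENNReal.tsum_mul_right, ENNReal.tsum_mul_left, hsum, hsum, one_mul, mul_one] at h
  have hpos : poissonMeasure r {0} ≠ 0 := by
    simp [poissonMeasure_singleton, Real.exp_pos]
  refine Measure.ext_of_singleton fun n => ?_
  have h := hratio n
  rw [← hzero, mul_comm] at h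
  exact (ENNReal.mul_right_inj hpos (measure_ne_top _ _)).mp h

theorem hasLaw_toMeasure [SFinite σ] [NullSingletonClass σ] [IsProbabilityMeasure P]
    (hP : IsPoissonMeasure σ P) {A : Set X} (hA : MeasurableSet A) (hσA : σ A ≠ ∞) :
    HasLaw (fun ω : Configuration X => ω.toMeasure A)
      ((poissonMeasure (σ A).toNNReal).map (fun m : ℕ => (m : ℝ≥0∞))) P := by
  have hN := hP.hasLaw_ncard hA hσA
  refine HasLaw.congr (X := fun ω : Configuration X => ((ω.carrier ∩ A).ncard : ℝ≥0∞)) ?_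
    (hP.ae_toMeasure_eq_ncard hA hσA)
  refine ⟨(measurable_from_nat.comp (measurable_ncard_inter hA)).aemeasurable, ?_⟩
  rw [← hN.map_eq, Measure.map_map .of_discrete (measurable_ncard_inter hA)]
  rfl

end IsPoissonMeasure

/-! ### Falling factorials, the iterated Mecke formula and moments -/

/-- Powers in terms of falling factorials. -/
lemma Nat.pow_eq_sum_stirlingSecond_mul_descFactorial (x n : ℕ) :
    x ^ n = ∑ k ∈ Finset.range (n + 1), Nat.stirlingSecond n k * x.descFactorial k := by
  induction n with
  | zero => simp
  | succ n ih =>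
    have hmul (k : ℕ) : x.descFactorial k * x = x.descFactorial (k + 1) + k * x.descFactorial k := by
      rw [Nat.descFactorial_succ, ← add_mul]
      rcases le_or_gt k x with h | h
      · rw [Nat.sub_add_cancel h, mul_comm]
      · simp [Nat.descFactorial_of_lt h]
    -- Reindexing is free at both ends: the factor k kills the bottom term and S(n, n+1) = 0 the top
    -- one.
    have hshift : ∑ k ∈ Finset.range (n + 1),
        (k + 1) * Nat.stirlingSecond n (k + 1) * x.descFactorial (k + 1) =
        ∑ k ∈ Finset.range (n + 1), k * Nat.stirlingSecond n k * x.descFactorial k := by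
      have h := Finset.sum_range_succ'
        (fun k => k * Nat.stirlingSecond n k * x.descFactorial k) (n + 1)
      rw [Finset.sum_range_succ, Nat.stirlingSecond_eq_zero_of_lt n.lt_succ_self] at h
      simpa using h.symm
    calc x ^ (n + 1) = ∑ k ∈ Finset.range (n + 1),
          Nat.stirlingSecond n k * (x.descFactorial k * x) := by
          rw [pow_succ, ih, Finset.sum_mul]
          exact Finset.sum_congr rfl fun k _ => mul_assoc _ _ _
      _ = ∑ k ∈ Finset.range (n + 1), k * Nat.stirlingSecond n k * x.descFactorial k +
          ∑ k ∈ Finset.range (n + 1), Nat.stirlingSecond n k * x.descFactorial (k + 1) := by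
          rw [← Finset.sum_add_distrib]
          exact Finset.sum_congr rfl fun k _ => by rw [hmul]; ring
      _ = ∑ k ∈ Finset.range (n + 2), Nat.stirlingSecond (n + 1) k * x.descFactorial k := by
          rw [← hshift, ← Finset.sum_add_distrib, Finset.sum_range_succ' _ (n + 1),
            Nat.stirlingSecond_succ_zero, zero_mul, add_zero]
          exact Finset.sum_congr rfl fun k _ => by rw [Nat.stirlingSecond_succ_succ]; ring

namespace Configuration

lemma addPoints_fin_zero {X : Type*} [TopologicalSpace X] (ω : Configuration X) (s : Fin 0 → X) :
    ω.addPoints s = ω := by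
  ext x
  simp [addPoints]

lemma addPoints_cons {X : Type*} [TopologicalSpace X] (ω : Configuration X) {k : ℕ} (x : X)
    (s : Fin k → X) :
    ω.addPoints (Fin.cons x s : Fin (k + 1) → X) =
      (ω.addPoints s).addPoints fun _ : Fin 1 => x := by
  ext y
  simp [addPoints, Fin.range_cons]

end Configuration

lemma integrable_uncurry_addOperator {X : Type*} [MetricSpace X] [SigmaCompactSpace X]
    [MeasurableSpace X] [BorelSpace X] {σ : Measure X} {P : Measure (Configuration X)}
    [IsProbabilityMeasure P] {A : Set X} {F : Configuration X → ℝ} {C : ℝ} (hσA : σ A ≠ ∞)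
    (hF : Measurable F) (hC : ∀ ω, |F ω| ≤ C) (k : ℕ) :
    Integrable (fun p : (Fin k → X) × Configuration X => addOperator p.1 F p.2)
      ((Measure.pi fun _ : Fin k => σ.restrict A).prod P) := by
  have : IsFiniteMeasure (σ.restrict A) := ⟨by simpa using hσA.lt_top⟩
  exact Integrable.of_bound (hF.comp (Configuration.measurable_addPoints k)).aestronglyMeasurable C
    (ae_of_all _ fun p => hC _)

namespace IsPoissonMeasure

open Configuration

variable {X : Type*} [MetricSpace X] [SigmaCompactSpace X] [MeasurableSpace X] [BorelSpace X]
  {σ : Measure X} [IsFiniteMeasureOnCompacts σ] [SigmaFinite σ] [NullSingletonClass σ]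
  {P : Measure (Configuration X)} [IsProbabilityMeasure P]

/-- The iterated Mecke formula, for the falling factorials of the number of points. -/
theorem lintegral_descFactorial_ncard_mul (hP : IsPoissonMeasure σ P) {A : Set X}
    (hA : MeasurableSet A) (hσA : σ A ≠ ∞) (k : ℕ) {G : Configuration X → ℝ≥0∞}
    (hG : Measurable G) :
    ∫⁻ ω, ((ω.carrier ∩ A).ncard.descFactorial k : ℝ≥0∞) * G ω ∂P =
      ∫⁻ s, ∫⁻ ω, G (ω.addPoints s) ∂P ∂Measure.pi fun _ : Fin k => σ.restrict A := by
  induction k generalizing G with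
  | zero =>
    have hGm : Measurable fun s : Fin 0 → X => ∫⁻ ω, G (ω.addPoints s) ∂P :=
      (hG.comp (measurable_addPoints 0)).lintegral_prod_right'
    rw [Measure.pi_of_empty, lintegral_dirac' _ hGm]
    simp [addPoints_fin_zero]
  | succ k ih =>
    -- One Mecke step consumes the factor m and shifts m - 1 back to m. Truncation at m = 0 is
    -- harmless because of that factor.
    have hdesc (m : ℕ) : (m.descFactorial (k + 1) : ℝ≥0∞) =
        m * ((m - 1).descFactorial k : ℝ≥0∞) := by
      cases m with
      | zero => simp
      | succ m => rw [Nat.succ_descFactorial_succ]; push_cast; rfl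
    simp_rw [hdesc]
    rw [hP.lintegral_ncard_mul hA hσA (fun m => ((m - 1).descFactorial k : ℝ≥0∞)) hG]
    simp_rw [Nat.add_sub_cancel]
    have hadd (x : X) : Measurable fun ω : Configuration X => ω.addPoints fun _ : Fin 1 => x :=
      (measurable_addPoints 1).comp measurable_prodMk_left
    have hmp := (measurePreserving_piFinSuccAbove
      (fun _ : Fin (k + 1) => σ.restrict A) 0).symm
    have hGm : Measurable fun s : Fin (k + 1) → X => ∫⁻ ω, G (ω.addPoints s) ∂P :=
      (hG.comp (measurable_addPoints (k + 1))).lintegral_prod_right'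
    rw [← hmp.lintegral_comp hGm, lintegral_prod (fun p : X × (Fin k → X) => ∫⁻ ω, G (ω.addPoints
      ((MeasurableEquiv.piFinSuccAbove (fun _ => X) 0).symm p)) ∂P)
      (hGm.comp hmp.measurable).aemeasurable]
    refine lintegral_congr fun x => ?_
    -- The induction hypothesis is applied to ω ↦ G(ω ∪ {x}), hence the generalization over G.
    refine (ih (hG.comp (hadd x))).trans ?_
    refine lintegral_congr fun s => lintegral_congr fun ω => ?_
    simp only [Function.comp_apply, ← addPoints_cons]
    congr 2
    simp [MeasurableEquiv.piFinSuccAbove_symm_apply, Fin.insertNthEquiv]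

/-- As an equality of measures, the iterated formula transfers both integrability and integrals to
signed F. -/
lemma withDensity_descFactorial_ncard (hP : IsPoissonMeasure σ P) {A : Set X}
    (hA : MeasurableSet A) (hσA : σ A ≠ ∞) (k : ℕ) :
    P.withDensity (fun ω => ((ω.carrier ∩ A).ncard.descFactorial k : ℝ≥0∞)) =
      ((Measure.pi fun _ : Fin k => σ.restrict A).prod P).map fun p => p.2.addPoints p.1 := by
  ext S hS
  have hadd := measurable_addPoints (X := X) k
  have h := hP.lintegral_descFactorial_ncard_mul hA hσA k (measurable_one.indicator hS)
  rw [withDensity_apply _ hS, Measure.map_apply hadd hS, Measure.prod_apply (hadd hS),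
    ← lintegral_indicator hS]
  convert h using 1
  · refine lintegral_congr fun ω => ?_
    by_cases hω : ω ∈ S <;> simp [hω]
  · refine lintegral_congr fun s => ?_
    rw [← lintegral_indicator_one (measurable_prodMk_left (hadd hS))]
    rfl

variable {A : Set X} {F : Configuration X → ℝ} {C : ℝ}

theorem integrable_descFactorial_ncard_mul (hP : IsPoissonMeasure σ P) (hA : MeasurableSet A)
    (hσA : σ A ≠ ∞) (hF : Measurable F) (hC : ∀ ω, |F ω| ≤ C) (k : ℕ) :
    Integrable (fun ω => ((ω.carrier ∩ A).ncard.descFactorial k : ℝ) * F ω) P := by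
  have hd : Measurable fun ω : Configuration X =>
      ((ω.carrier ∩ A).ncard.descFactorial k : ℝ≥0∞) :=
    (measurable_from_nat (f := fun m => (m.descFactorial k : ℝ≥0∞))).comp
      (measurable_ncard_inter hA)
  have h := (integrable_withDensity_iff_integrable_smul' (μ := P) hd
    (ae_of_all _ fun ω => ENNReal.natCast_lt_top _) (g := F)).mp (by
      rw [hP.withDensity_descFactorial_ncard hA hσA,
        integrable_map_measure hF.aestronglyMeasurable (measurable_addPoints k).aemeasurable]
      exact integrable_uncurry_addOperator hσA hF hC k)
  simpa using h

theorem integral_descFactorial_ncard_mul (hP : IsPoissonMeasure σ P) (hA : MeasurableSet A)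
    (hσA : σ A ≠ ∞) (hF : Measurable F) (hC : ∀ ω, |F ω| ≤ C) (k : ℕ) :
    ∫ ω, ((ω.carrier ∩ A).ncard.descFactorial k : ℝ) * F ω ∂P =
      ∫ s in univ.pi fun _ : Fin k => A, (∫ ω, addOperator s F ω ∂P)
        ∂Measure.pi fun _ : Fin k => σ := by
  have hd : Measurable fun ω : Configuration X =>
      ((ω.carrier ∩ A).ncard.descFactorial k : ℝ≥0∞) :=
    (measurable_from_nat (f := fun m => (m.descFactorial k : ℝ≥0∞))).comp
      (measurable_ncard_inter hA)
  have h := integral_withDensity_eq_integral_toReal_smul (μ := P) hd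
    (ae_of_all _ fun ω => ENNReal.natCast_lt_top _) F
  rw [hP.withDensity_descFactorial_ncard hA hσA,
    integral_map (measurable_addPoints k).aemeasurable hF.aestronglyMeasurable] at h
  rw [Measure.restrict_pi_pi, ← integral_prod _ (integrable_uncurry_addOperator hσA hF hC k)]
  simpa [addOperator] using h.symm

lemma mul_toMeasure_real_pow_eq_sum (hA : MeasurableSet A) (n : ℕ) (ω : Configuration X) :
    F ω * ω.toMeasure.real A ^ n = ∑ k ∈ Finset.range (n + 1),
      (Nat.stirlingSecond n k : ℝ) * (((ω.carrier ∩ A).ncard.descFactorial k : ℝ) * F ω) := by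
  rw [ω.toMeasure_real_eq_ncard hA, ← Nat.cast_pow,
    Nat.pow_eq_sum_stirlingSecond_mul_descFactorial, Nat.cast_sum, Finset.mul_sum]
  exact Finset.sum_congr rfl fun k _ => by push_cast; ring

theorem integrable_mul_toMeasure_real_pow (hP : IsPoissonMeasure σ P) (hA : MeasurableSet A)
    (hσA : σ A ≠ ∞) (hF : Measurable F) (hC : ∀ ω, |F ω| ≤ C) (n : ℕ) :
    Integrable (fun ω => F ω * ω.toMeasure.real A ^ n) P := by
  simp_rw [mul_toMeasure_real_pow_eq_sum hA]
  exact integrable_finsetSum _ fun k _ =>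
    (hP.integrable_descFactorial_ncard_mul hA hσA hF hC k).const_mul _

theorem integral_mul_toMeasure_real_pow (hP : IsPoissonMeasure σ P) (hA : MeasurableSet A)
    (hσA : σ A ≠ ∞) (hF : Measurable F) (hC : ∀ ω, |F ω| ≤ C) (n : ℕ) :
    ∫ ω, F ω * ω.toMeasure.real A ^ n ∂P =
      ∑ k ∈ Finset.range (n + 1), (Nat.stirlingSecond n k : ℝ) *
        ∫ s in univ.pi (fun _ : Fin k => A), (∫ ω, addOperator s F ω ∂P)
          ∂(Measure.pi fun _ : Fin k => σ) := by
  simp_rw [mul_toMeasure_real_pow_eq_sum hA]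
  rw [integral_finsetSum _ fun k _ =>
    (hP.integrable_descFactorial_ncard_mul hA hσA hF hC k).const_mul _]
  refine Finset.sum_congr rfl fun k _ => ?_
  rw [integral_const_mul, hP.integral_descFactorial_ncard_mul hA hσA hF hC]

end IsPoissonMeasure

theorem corollary4p1 {X : Type*} [MetricSpace X] [SigmaCompactSpace X]
    [MeasurableSpace X] [BorelSpace X]
    (σ : Measure X) [SigmaFinite σ] [NullSingletonClass σ] [IsFiniteMeasureOnCompacts σ]
    (P : Measure (Configuration X)) [IsProbabilityMeasure P] (hP : IsPoissonMeasure σ P)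
    (A : Set X) (hA : MeasurableSet A) (hσA : σ A < ∞) :
    -- the count `ω(A)` is Poisson distributed with parameter `σ(A)`
    HasLaw (fun ω : Configuration X => ω.toMeasure A)
      ((poissonMeasure (σ A).toNNReal).map (fun m : ℕ => (m : ℝ≥0∞))) P ∧
    -- the moment identity, together with the integrability that gives its two sides a meaning
    (∀ F : Configuration X → ℝ, Measurable F → (∃ C : ℝ, ∀ ω, |F ω| ≤ C) → ∀ n : ℕ,
      Integrable (fun ω => F ω * ω.toMeasure.real A ^ n) P ∧
      (∀ (k : ℕ) (s : Fin k → X), Integrable (addOperator s F) P) ∧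
      (∀ k : ℕ, IntegrableOn (fun s : Fin k → X => ∫ ω, addOperator s F ω ∂P)
        (Set.univ.pi fun _ => A) (Measure.pi fun _ => σ)) ∧
      ∫ ω, F ω * ω.toMeasure.real A ^ n ∂P =
        ∑ k ∈ Finset.range (n + 1), (Nat.stirlingSecond n k : ℝ) *
          ∫ s in Set.univ.pi (fun _ : Fin k => A), (∫ ω, addOperator s F ω ∂P)
            ∂(Measure.pi fun _ : Fin k => σ)) ∧
    -- the case `F = 1`
    (∀ n : ℕ, ∫ ω, ω.toMeasure.real A ^ n ∂P = bellPolynomial n (σ.real A)) := by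
  refine ⟨hP.hasLaw_toMeasure hA hσA.ne, fun F hF ⟨C, hC⟩ n =>
    ⟨hP.integrable_mul_toMeasure_real_pow hA hσA.ne hF hC n, fun k s => ?_, fun k => ?_,
      hP.integral_mul_toMeasure_real_pow hA hσA.ne hF hC n⟩, fun n => ?_⟩
  · exact Integrable.of_bound (hF.comp ((Configuration.measurable_addPoints k).comp
      measurable_prodMk_left)).aestronglyMeasurable C (ae_of_all _ fun ω => hC _)
  · rw [IntegrableOn, Measure.restrict_pi_pi]
    exact (integrable_uncurry_addOperator hσA.ne hF hC k).integral_prod_left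
  · have h := hP.integral_mul_toMeasure_real_pow hA hσA.ne (F := fun _ => 1) (C := 1)
      measurable_const (by simp) n
    simp only [one_mul] at h
    rw [h, bellPolynomial]
    refine Finset.sum_congr rfl fun k _ => ?_
    simp [addOperator, measureReal_def, Measure.pi_pi]
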